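/- **Conventions.** A characteristic function (CF) is the Fourier transform $g(t)=\int e^{itx}\,d\mu(x)$, $t\in\mathbf R$, of a probability measure $\mu$ on $\mathbf R$. Let $\varphi(s)=\int_{[0,\infty)}e^{-sx}\,d\nu(x)$, $\operatorname{Re}s\ge 0$, be the Laplace transform of a probability measure $\nu$ on $[0,\infty)$, and assume that $\varphi^{-1}$ makes sense near $1=\varphi(0)$: for some $\varepsilon>0$, $\varphi$ is injective on $\{s\in\mathbf C:\operatorname{Re}s\ge 0,\ |s|<\varepsilon\}$. (This holds, for example, whenever $\nu$ has a finite non-zero mean, and for exponential, gamma and positive stable $\nu$.) A CF $\omega$ is *semi-stable* (in the sense of Lévy) if it is infinitely divisible and $\omega=e^{-\psi}$, where $\psi$ is continuous, $\psi(0)=0$, and there are $a>1$ and $0<b<1$ with $\psi(t)=a\,\psi(bt)$ for all $t\in\mathbf R$. A CF $f$ is *$\varphi$-semi-stable* if $f(t)=\varphi(\psi(t))$ for all $t$, where $\psi=-\log\omega$ (the continuous logarithm vanishing at $0$) for some semi-stable CF $\omega$. **Theorem 4.3.** Let $f$ be a CF. Then the following are equivalent. 1. The strict-sense domain of partial $\varphi$-attraction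 of $f$, along sequences with $\liminf n_k/n_{k+1}>0$, is nonempty: there are a CF $g$, positive integers $n_k\to\infty$ with $\liminf_{k\to\infty} n_k/n_{k+1}>0$, and real numbers $a_k>0$ such that $$\lim_{k\to\infty}\varphi\{n_k(1-g(t/a_k))\}=f(t)\qquad\text{for all } t\in\mathbf R .$$ 2. $f$ is $\varphi$-semi-stable. -/

import Mathlib

open MeasureTheory Filter Topology

/-- `f : ℝ → ℂ` is the characteristic function of a probability measure on the line,
`f t = ∫ exp (i t x) dμ(x)`. -/
def IsCharFn (f : ℝ → ℂ) : Prop :=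
  ∃ μ : Measure ℝ, IsProbabilityMeasure μ ∧ ∀ t : ℝ, f t = charFun μ t

/-- `φ` is, on the closed right half-plane, the Laplace transform of a probability measure
carried by `[0, ∞)`. Nothing is said about `φ` elsewhere. -/
def IsLaplaceTransform (φ : ℂ → ℂ) : Prop :=
  ∃ ν : Measure ℝ, IsProbabilityMeasure ν ∧ ν (Set.Iio 0) = 0 ∧
    ∀ s : ℂ, 0 ≤ s.re → φ s = ∫ x : ℝ, Complex.exp (-s * (x : ℂ)) ∂ν

/-- `φ` has an inverse near `φ 0 = 1`: it is injective on a half-disc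
`{s | 0 ≤ Re s, |s| < ε}`. -/
def IsInvertibleNearZero (φ : ℂ → ℂ) : Prop :=
  ∃ ε : ℝ, 0 < ε ∧ Set.InjOn φ {s : ℂ | 0 ≤ s.re ∧ ‖s‖ < ε}

/-- A characteristic function all of whose `n`-th roots, for a suitable choice of the root, are
characteristic functions. -/
def IsInfinitelyDivisibleCF (ω : ℝ → ℂ) : Prop :=
  IsCharFn ω ∧ ∀ n : ℕ, 1 ≤ n → ∃ g : ℝ → ℂ, IsCharFn g ∧ ∀ t : ℝ, ω t = g t ^ n

/-- `ψ = -log ω`, where `log` is the distinguished logarithm: the (unique) continuous function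
with `ψ 0 = 0` and `ω = exp (-ψ)`. -/
structure IsNegLog (ψ ω : ℝ → ℂ) : Prop where
  continuous : Continuous ψ
  zero : ψ 0 = 0
  exp_neg : ∀ t : ℝ, ω t = Complex.exp (-ψ t)

/-- Semi-stability in the sense of Lévy: `ω` is infinitely divisible and `ψ = -log ω` satisfies
`ψ t = a ψ (b t)` for some `a > 1` and `0 < b < 1`, that is, `ω t = ω (b t) ^ a`. -/
def IsSemiStable (ω : ℝ → ℂ) : Prop :=
  IsInfinitelyDivisibleCF ω ∧
    ∃ ψ : ℝ → ℂ, IsNegLog ψ ω ∧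
      ∃ a b : ℝ, 1 < a ∧ 0 < b ∧ b < 1 ∧ ∀ t : ℝ, ψ t = (a : ℂ) * ψ (b * t)

/-- `f = φ (-log ω)` for a semi-stable characteristic function `ω`. -/
def IsPhiSemiStable (φ : ℂ → ℂ) (f : ℝ → ℂ) : Prop :=
  ∃ ω ψ : ℝ → ℂ, IsSemiStable ω ∧ IsNegLog ψ ω ∧ ∀ t : ℝ, f t = φ (ψ t)

/-- `g` is partially `φ`-attracted to `f` along `n` with scaling constants `a` and centering
constants `b`: with `g_k t = g (t / a_k) exp (-i t b_k)`, one has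
`φ (n_k (1 - g_k t)) → f t` for every real `t`, the `n_k` being positive integers tending to
infinity and the `a_k` being positive. -/
structure PartiallyAttracted (φ : ℂ → ℂ) (g f : ℝ → ℂ) (n : ℕ → ℕ) (a b : ℕ → ℝ) : Prop where
  n_pos : ∀ k, 0 < n k
  n_tendsto : Tendsto n atTop atTop
  a_pos : ∀ k, 0 < a k
  tendsto : ∀ t : ℝ,
    Tendsto
      (fun k => φ ((n k : ℂ) * (1 - g (t / a k) * Complex.exp (-(Complex.I * (t : ℂ) * (b k : ℂ))))))
      atTop (𝓝 (f t))

/-- The strict-sense (`b_k = 0`) domain of partial `φ`-attraction of `f`, restricted to sequences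
`n_k` with `liminf n_k / n_{k+1} > 0`. The lower limit is taken in the extended reals. -/
def strictPartialDomain (φ : ℂ → ℂ) (f : ℝ → ℂ) : Set (ℝ → ℂ) :=
  {g | IsCharFn g ∧ ∃ (n : ℕ → ℕ) (a : ℕ → ℝ),
    PartiallyAttracted φ g f n a (fun _ => 0) ∧
      0 < liminf (fun k => (((n k : ℝ) / (n (k + 1) : ℝ) : ℝ) : EReal)) atTop}

/-! Write `h_k(t) = n_k(1 - g(t/a_k))`, so that `φ(h_k) → f`. If `h_k → Ψ` everywhere, then `f =
φ(Ψ)` and `g(t/a_k)^⌊n_k/m⌋ → exp(-Ψ/m)`, which makes `exp(-Ψ)` infinitely divisible. The difficulty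
is that `φ` can be inverted only near `0`.

Near `0` (`exists_localLimit`): each `φ(h_k)` is a characteristic function, so the convergence is
locally uniform. Since `h_k(0) = 0` and `h_k` is continuous, `h_k` cannot leave a half-disc of
injectivity while `φ(h_k)` is close to `1`. Hence `h_k` converges to some `ψ` on an interval `[-t₀,
t₀]`.

Away from `0` (`LocalLimit.hasContractions`, `LocalLimit.extend`): bounded ratios `n_{k+1}/n_k` give
`h_k(t) = R_k h_{u(k)}(β_k t)` with `R_k` in a compact subset of `(1, ∞)` and `β_k` eventually as
small as desired. Subsequential limits of `(R_k, β_k)` yield `ψ(t) = a ψ(bt)` near `0` and transport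
the convergence to arbitrarily long intervals. If `ψ` vanishes near `0`, then `f = 1` identically.

Conversely, if `ψ(t) = a ψ(bt)`, then `ω = exp(-ψ)` is itself attracted, because `a^k(1 -
exp(-ψ(t)/a^k)) → ψ(t)`. -/

/-! ### Characteristic functions -/

namespace IsCharFn

variable {f g : ℝ → ℂ}

theorem continuous (hf : IsCharFn f) : Continuous f := by
  obtain ⟨μ, hμ, h⟩ := hf
  rw [show f = charFun μ from funext h]
  exact continuous_charFun

theorem zero (hf : IsCharFn f) : f 0 = 1 := by
  obtain ⟨μ, hμ, h⟩ := hf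
  simp [h, charFun_zero]

theorem norm_le (hf : IsCharFn f) (t : ℝ) : ‖f t‖ ≤ 1 := by
  obtain ⟨μ, hμ, h⟩ := hf
  rw [h]
  exact norm_charFun_le_one t

theorem one_sub_re_nonneg (hf : IsCharFn f) (t : ℝ) : 0 ≤ (1 - f t).re := by
  have := (Complex.re_le_norm (f t)).trans (hf.norm_le t)
  simpa using this

theorem one : IsCharFn (fun _ => 1) :=
  ⟨Measure.dirac 0, inferInstance, fun t => by simp⟩

theorem mul (hf : IsCharFn f) (hg : IsCharFn g) : IsCharFn (fun t => f t * g t) := by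
  obtain ⟨μ, hμ, h⟩ := hf
  obtain ⟨ν, hν, h'⟩ := hg
  exact ⟨μ ∗ ν, inferInstance, fun t => by simp only [charFun_conv, h, h']⟩

theorem pow (hf : IsCharFn f) (n : ℕ) : IsCharFn (fun t => f t ^ n) := by
  induction n with
  | zero => simpa using one
  | succ n ih => simpa only [pow_succ] using ih.mul hf

theorem comp_mul (hf : IsCharFn f) (r : ℝ) : IsCharFn (fun t => f (r * t)) := by
  obtain ⟨μ, hμ, h⟩ := hf
  exact ⟨μ.map (r * ·), Measure.isProbabilityMeasure_map (by fun_prop), fun t => by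
    simp only [charFun_map_mul, h]⟩

theorem comp_div (hf : IsCharFn f) (r : ℝ) : IsCharFn (fun t => f (t / r)) := by
  simpa only [div_eq_inv_mul] using hf.comp_mul r⁻¹

/-- A pointwise limit of characteristic functions that is continuous at `0` is a characteristic
function. -/
theorem of_tendsto {F : ℕ → ℝ → ℂ} (hF : ∀ k, IsCharFn (F k)) (hf : ContinuousAt f 0)
    (h : ∀ t, Tendsto (fun k => F k t) atTop (𝓝 (f t))) : IsCharFn f := by
  choose μ hμ hFμ using hF
  have h' : ∀ t, Tendsto (fun k => charFun (μ k) t) atTop (𝓝 (f t)) := fun t => by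
    simpa only [hFμ] using h t
  let P : ℕ → ProbabilityMeasure ℝ := fun k => ⟨μ k, hμ k⟩
  -- Prokhorov: tightness gives a weakly convergent subsequence, whose limit must have
  -- characteristic function `f`.
  have htight : IsTightMeasureSet
      {((ρ : ProbabilityMeasure ℝ) : Measure ℝ) | ρ ∈ Set.range P} := by
    have := isTightMeasureSet_of_tendsto_charFun hf h'
    convert! this using 1
    ext ρ
    exact ⟨fun ⟨_, ⟨k, hk⟩, h⟩ => ⟨k, by rw [← h, ← hk]; rfl⟩, fun ⟨k, hk⟩ => ⟨P k, ⟨k, rfl⟩, hk⟩⟩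
  obtain ⟨ρ, -, u, hu, hρ⟩ := (isCompact_closure_of_isTightMeasureSet htight).isSeqCompact
    (x := P) (fun k => subset_closure ⟨k, rfl⟩)
  refine ⟨ρ, inferInstance, fun t => ?_⟩
  have := ProbabilityMeasure.tendsto_iff_tendsto_charFun.1 hρ t
  exact tendsto_nhds_unique ((h' t).comp hu.tendsto_atTop) this

/-- Taking real parts, `1 - cos(tx) ≥ 0` has integral `0`, so `exp(itx) = 1` almost everywhere, and
so is its square. -/
theorem double_eq_one (hf : IsCharFn f) {t : ℝ} (ht : f t = 1) : f (2 * t) = 1 := by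
  obtain ⟨μ, hμ, h⟩ := hf
  have hi : ∀ s : ℝ, Integrable (fun x : ℝ => Complex.exp (s * x * Complex.I)) μ := fun s =>
    (integrable_const (1 : ℝ)).mono (by fun_prop)
      (ae_of_all _ fun x => by
        rw [← Complex.ofReal_mul, Complex.norm_exp_ofReal_mul_I]; simp)
  have hcos : ∫ x, (1 - Real.cos (t * x)) ∂μ = 0 := by
    have h1 : ∫ x, (1 - Complex.exp (t * x * Complex.I)) ∂μ = 0 := by
      rw [integral_sub (integrable_const _) (hi t), ← charFun_apply_real, ← h, ht]
      simp
    have h2 := congrArg Complex.re h1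
    rw [← RCLike.re_eq_complex_re, ← integral_re (f := fun x : ℝ => 1 - Complex.exp (t * x * Complex.I))
      ((integrable_const (1 : ℂ)).sub (hi t))] at h2
    simp only [RCLike.re_eq_complex_re, map_zero] at h2
    rw [← h2]
    refine integral_congr_ae (ae_of_all _ fun x => ?_)
    simp only [Complex.sub_re, Complex.one_re]
    rw [← Complex.ofReal_mul, Complex.exp_ofReal_mul_I_re]
  have hae : ∀ᵐ x ∂μ, 1 - Real.cos (t * x) = 0 := by
    refine (integral_eq_zero_iff_of_nonneg (fun x => ?_) ?_).1 hcos
    · simpa using Real.cos_le_one (t * x)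
    · refine (integrable_const (2 : ℝ)).mono (by fun_prop) (ae_of_all _ fun x => ?_)
      have h1 := Real.cos_le_one (t * x)
      have h2 := Real.neg_one_le_cos (t * x)
      rw [Real.norm_eq_abs, abs_of_nonneg (by linarith)]
      simp only [Real.norm_eq_abs]
      norm_num
      linarith
  rw [h, charFun_apply_real]
  have : ∫ x, Complex.exp (((2 * t : ℝ) : ℂ) * x * Complex.I) ∂μ = ∫ _, (1 : ℂ) ∂μ := by
    refine integral_congr_ae (hae.mono fun x hx => ?_)
    have hc : Real.cos (t * x) = 1 := by linarith
    have hs : Real.sin (t * x) = 0 := by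
      have := Real.sin_sq_add_cos_sq (t * x)
      rw [hc] at this
      nlinarith
    have he : Complex.exp ((t * x : ℝ) * Complex.I) = 1 := by
      rw [Complex.exp_mul_I, ← Complex.ofReal_cos, ← Complex.ofReal_sin, hc, hs]
      simp
    have : (((2 * t : ℝ) : ℂ) * x * Complex.I) = (t * x : ℝ) * Complex.I + (t * x : ℝ) * Complex.I := by
      push_cast; ring
    simp only [this, Complex.exp_add, he, mul_one]
  rw [this]
  simp

theorem eq_one_of_eventually (hf : IsCharFn f) (h : ∀ᶠ t in 𝓝 0, f t = 1) (t : ℝ) : f t = 1 := by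
  have hlim : Tendsto (fun m : ℕ => (2⁻¹ : ℝ) ^ m * t) atTop (𝓝 0) := by
    simpa using (tendsto_pow_atTop_nhds_zero_of_lt_one (by norm_num : (0 : ℝ) ≤ 2⁻¹)
      (by norm_num)).mul_const t
  obtain ⟨m, hm⟩ := (hlim.eventually h).exists
  have hdbl : ∀ j : ℕ, f (2 ^ j * ((2⁻¹ : ℝ) ^ m * t)) = 1 := by
    intro j
    induction j with
    | zero => simpa using hm
    | succ j ih => simpa only [pow_succ', mul_assoc] using hf.double_eq_one ih
  have := hdbl m
  rwa [← mul_assoc, ← mul_pow, mul_inv_cancel₀ (two_ne_zero), one_pow, one_mul] at this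

/-- Pointwise convergence of characteristic functions to a characteristic function is continuous
convergence. -/
theorem tendsto_prod {F : ℕ → ℝ → ℂ} (hF : ∀ k, IsCharFn (F k)) (hf : IsCharFn f)
    (h : ∀ t, Tendsto (fun k => F k t) atTop (𝓝 (f t))) (t : ℝ) :
    Tendsto (fun p : ℕ × ℝ => F p.1 p.2) (atTop ×ˢ 𝓝 t) (𝓝 (f t)) := by
  choose μ hμ hFμ using hF
  have htight : IsTightMeasureSet (Set.range μ) :=
    isTightMeasureSet_of_tendsto_charFun hf.continuous.continuousAt
      (fun t => by simpa only [hFμ] using h t)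
  -- Tightness yields uniform equicontinuity: on `|s| ≤ A` the exponentials differ by at most `|x -
  -- y| A`, and the remaining mass is at most `ε/2`, where they differ by at most `2`.
  have key : ∀ ε : ℝ, 0 < ε → ∃ A : ℝ, 0 < A ∧ ∀ k x y,
      ‖F k x - F k y‖ ≤ |x - y| * A + ε := by
    intro ε hε
    have := (tendsto_measure_norm_gt_of_isTightMeasureSet htight).eventually
      (gt_mem_nhds (show (0 : ENNReal) < ENNReal.ofReal (ε / 2) by simpa using hε))
    obtain ⟨A, hA, hA0⟩ := (this.and (eventually_gt_atTop 0)).exists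
    refine ⟨A, hA0, fun k x y => ?_⟩
    have hAk : (μ k).real {s | A < ‖s‖} ≤ ε / 2 := by
      rw [Measure.real]
      refine ENNReal.toReal_le_of_le_ofReal (by positivity) (le_trans ?_ hA.le)
      exact le_iSup₂_of_le (μ k) ⟨k, rfl⟩ le_rfl
    have hi : ∀ s : ℝ, Integrable (fun x : ℝ => Complex.exp (s * x * Complex.I)) (μ k) := fun s =>
      (integrable_const (1 : ℝ)).mono (by fun_prop)
        (ae_of_all _ fun x => by
          rw [← Complex.ofReal_mul, Complex.norm_exp_ofReal_mul_I]; simp)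
    have hms : MeasurableSet {s : ℝ | A < ‖s‖} := measurableSet_lt (by fun_prop) (by fun_prop)
    rw [hFμ, hFμ, charFun_apply_real, charFun_apply_real, ← integral_sub (hi x) (hi y)]
    calc ‖∫ s : ℝ, (Complex.exp (x * s * Complex.I) - Complex.exp (y * s * Complex.I)) ∂(μ k)‖
        ≤ ∫ s : ℝ, (|x - y| * A + {s : ℝ | A < ‖s‖}.indicator (fun _ => (2 : ℝ)) s) ∂(μ k) := by
          refine norm_integral_le_of_norm_le ((integrable_const _).add
            ((integrable_const _).indicator hms)) (ae_of_all _ fun s => ?_)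
          have e1 : ∀ z : ℝ, ‖Complex.exp (z * s * Complex.I)‖ = 1 := fun z => by
            rw [← Complex.ofReal_mul, Complex.norm_exp_ofReal_mul_I]
          by_cases hs : A < ‖s‖
          · rw [Set.indicator_of_mem (by exact hs)]
            have := norm_sub_le (Complex.exp (x * s * Complex.I)) (Complex.exp (y * s * Complex.I))
            rw [e1, e1] at this
            have : 0 ≤ |x - y| * A := by positivity
            linarith
          · rw [Set.indicator_of_notMem (by exact hs), add_zero]
            have e2 : Complex.exp (x * s * Complex.I) - Complex.exp (y * s * Complex.I)
                = Complex.exp (y * s * Complex.I)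
                  * (Complex.exp (Complex.I * ((x - y) * s : ℝ)) - 1) := by
              rw [mul_sub, ← Complex.exp_add, mul_one]
              congr 2
              push_cast; ring
            rw [e2, norm_mul, e1, one_mul]
            refine (Real.norm_exp_I_mul_ofReal_sub_one_le).trans ?_
            rw [Real.norm_eq_abs, abs_mul]
            gcongr
            simpa using hs
      _ = |x - y| * A + (μ k).real {s | A < ‖s‖} * 2 := by
          rw [integral_add (integrable_const _) ((integrable_const _).indicator hms),
            integral_indicator_const _ hms]
          simp
      _ ≤ |x - y| * A + ε := by linarith
  rw [Metric.tendsto_nhds]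
  intro ε hε
  obtain ⟨A, hA, hb⟩ := key (ε / 3) (by positivity)
  have h1 : ∀ᶠ k in atTop, dist (F k t) (f t) < ε / 3 := (Metric.tendsto_nhds.1 (h t)) _ (by positivity)
  have h2 : ∀ᶠ x in 𝓝 t, dist x t < ε / (3 * A) := Metric.ball_mem_nhds t (by positivity)
  filter_upwards [h1.prod_mk h2] with p hp
  have h3 := hb p.1 p.2 t
  have h4 : |p.2 - t| * A < ε / 3 := by
    have := hp.2
    rw [Real.dist_eq, lt_div_iff₀ (by positivity)] at this
    linarith
  calc dist (F p.1 p.2) (f t) ≤ dist (F p.1 p.2) (F p.1 t) + dist (F p.1 t) (f t) :=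
        dist_triangle _ _ _
    _ < ε := by
      rw [dist_eq_norm (F p.1 p.2)]
      linarith [hp.1]

end IsCharFn

theorem IsCharFn.of_hasSum {w : ℕ → ℝ} {F : ℕ → ℝ → ℂ} {f : ℝ → ℂ} (hw0 : ∀ m, 0 ≤ w m)
    (hw : HasSum w 1) (hF : ∀ m, IsCharFn (F m))
    (h : ∀ t, HasSum (fun m => (w m : ℂ) * F m t) (f t)) : IsCharFn f := by
  choose μ hμ hFμ using hF
  let ρ : Measure ℝ := Measure.sum fun m => ENNReal.ofReal (w m) • μ m
  have hρ : IsProbabilityMeasure ρ := ⟨by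
    rw [Measure.sum_apply _ MeasurableSet.univ]
    simp only [Measure.smul_apply, measure_univ, smul_eq_mul, mul_one]
    rw [← ENNReal.ofReal_tsum_of_nonneg hw0 hw.summable, hw.tsum_eq, ENNReal.ofReal_one]⟩
  refine ⟨ρ, hρ, fun t => ?_⟩
  have hi : Integrable (fun x : ℝ => Complex.exp (t * x * Complex.I)) ρ :=
    (integrable_const (1 : ℝ)).mono (by fun_prop)
      (ae_of_all _ fun x => by
        rw [← Complex.ofReal_mul, Complex.norm_exp_ofReal_mul_I]; simp)
  have := hasSum_integral_measure hi
  rw [← charFun_apply_real] at this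
  refine (h t).unique ?_
  convert! this using 2 with m
  rw [integral_smul_measure, ← charFun_apply_real, hFμ, ENNReal.toReal_ofReal (hw0 m)]
  simp

/-! ### Laplace transforms -/

namespace IsLaplaceTransform

variable {φ : ℂ → ℂ}

theorem zero (hφ : IsLaplaceTransform φ) : φ 0 = 1 := by
  obtain ⟨ν, hν, -, h⟩ := hφ
  rw [h 0 le_rfl]
  simp

theorem ae_nonneg {ν : Measure ℝ} (h : ν (Set.Iio 0) = 0) : ∀ᵐ x ∂ν, 0 ≤ x := by
  rw [ae_iff]
  convert! h using 2
  ext x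
  simp

theorem norm_exp_neg_mul_le {s : ℂ} (hs : 0 ≤ s.re) {x : ℝ} (hx : 0 ≤ x) :
    ‖Complex.exp (-s * x)‖ ≤ 1 := by
  rw [Complex.norm_exp]
  simp only [Complex.mul_re, Complex.neg_re, Complex.ofReal_re, Complex.ofReal_im, mul_zero,
    sub_zero, Real.exp_le_one_iff]
  nlinarith [mul_nonneg hs hx]

theorem continuousOn (hφ : IsLaplaceTransform φ) : ContinuousOn φ {s | 0 ≤ s.re} := by
  obtain ⟨ν, hν, hν0, h⟩ := hφ
  refine ContinuousOn.congr ?_ (fun s hs => h s hs)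
  refine continuousOn_of_dominated (bound := fun _ => 1) (fun s _ => by fun_prop)
    (fun s hs => (ae_nonneg hν0).mono fun x hx => norm_exp_neg_mul_le hs hx)
    (integrable_const _) (ae_of_all _ fun x => by fun_prop)

/-- If `g` is a characteristic function, so is `φ (c (1 - g))`: it belongs to a mixture of compound
Poisson laws. -/
theorem isCharFn_comp (hφ : IsLaplaceTransform φ) {g : ℝ → ℂ} (hg : IsCharFn g) {c : ℝ}
    (hc : 0 ≤ c) : IsCharFn (fun t => φ ((c : ℂ) * (1 - g t))) := by
  obtain ⟨ν, hν, hν0, h⟩ := hφ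
  have hnn := ae_nonneg hν0
  -- Poisson weights of mean `cx`. Their generating function at `z` is `exp(-c(1 - z)x)`;
  -- integrating in `x` against `ν` expands `φ(c(1 - z))` as a power series in `z` with nonnegative
  -- coefficients.
  let p : ℕ → ℝ → ℝ := fun m x => Real.exp (-c * x) * ((c * x) ^ m / m.factorial)
  have hp0 : ∀ m x, 0 ≤ x → 0 ≤ p m x := fun m x hx => by positivity
  have hps : ∀ x, HasSum (fun m => p m x) 1 := fun x => by
    have := (NormedSpace.expSeries_div_hasSum_exp (c * x)).mul_left (Real.exp (-c * x))
    rw [← Real.exp_eq_exp_ℝ, ← Real.exp_add] at this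
    simpa [p] using this
  have key : ∀ z : ℂ, ‖z‖ ≤ 1 →
      HasSum (fun m => ((∫ x, p m x ∂ν : ℝ) : ℂ) * z ^ m) (φ ((c : ℂ) * (1 - z))) := by
    intro z hz
    have hre : 0 ≤ ((c : ℂ) * (1 - z)).re := by
      have := (Complex.re_le_norm z).trans hz
      simp only [Complex.mul_re, Complex.ofReal_re, Complex.sub_re, Complex.one_re,
        Complex.ofReal_im, zero_mul, sub_zero]
      exact mul_nonneg hc (by linarith)
    rw [h _ hre]
    have hsum := hasSum_integral_of_dominated_convergence (μ := ν)
      (F := fun m x => ((p m x : ℝ) : ℂ) * z ^ m)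
      (f := fun x : ℝ => Complex.exp (-((c : ℂ) * (1 - z)) * x)) p
      (fun m => by fun_prop)
      (fun m => hnn.mono fun x hx => by
        rw [norm_mul, norm_pow, Complex.norm_real, Real.norm_of_nonneg (hp0 m x hx)]
        exact mul_le_of_le_one_right (hp0 m x hx) (pow_le_one₀ (norm_nonneg _) hz))
      (ae_of_all _ fun x => (hps x).summable)
      (by simp only [(hps _).tsum_eq]; exact integrable_const _)
      (ae_of_all _ fun x => by
        have := (NormedSpace.expSeries_div_hasSum_exp ((c : ℂ) * x * z)).mul_left
          (Complex.exp (-c * x))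
        rw [← Complex.exp_eq_exp_ℂ, ← Complex.exp_add] at this
        convert! this using 2 with m
        · simp only [p]
          push_cast
          ring
        · ring)
    convert! hsum using 2 with m
    rw [integral_mul_const, integral_complex_ofReal]
  -- The case `z = 1`: the mixing weights have total mass `φ 0 = 1`.
  have hw : HasSum (fun m => ∫ x, p m x ∂ν) 1 := by
    have := key 1 (by simp)
    rw [sub_self, mul_zero, h 0 le_rfl] at this
    simp only [one_pow, mul_one, neg_zero, zero_mul, Complex.exp_zero, integral_const,
      probReal_univ, one_smul] at this
    rw [← Complex.hasSum_ofReal]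
    simpa using this
  exact IsCharFn.of_hasSum (F := fun m t => g t ^ m)
    (fun m => integral_nonneg_of_ae (hnn.mono fun x hx => hp0 m x hx)) hw
    (fun m => hg.pow m) (fun t => key (g t) (hg.norm_le t))

end IsLaplaceTransform

/-! ### Auxiliary limits and bounded ratios -/

/-- Here `z → 0`, so `q log(1 + z) = qz + O(qz · z)`, whose error term vanishes in the limit. -/
theorem tendsto_one_add_pow_exp {q : ℕ → ℕ} {z : ℕ → ℂ} {w : ℂ} (hq : Tendsto q atTop atTop)
    (h : Tendsto (fun k => (q k : ℂ) * z k) atTop (𝓝 w)) :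
    Tendsto (fun k => (1 + z k) ^ q k) atTop (𝓝 (Complex.exp w)) := by
  have hq' : Tendsto (fun k => (q k : ℂ)⁻¹) atTop (𝓝 0) :=
    tendsto_inv_atTop_nhds_zero_nat.comp hq
  have hz : Tendsto z atTop (𝓝 0) := by
    have := hq'.mul h
    rw [zero_mul] at this
    refine this.congr' ?_
    filter_upwards [hq.eventually_gt_atTop 0] with k hk
    have : (q k : ℂ) ≠ 0 := by exact_mod_cast hk.ne'
    field_simp
  have hO := (Complex.log_sub_self_isBigO.comp_tendsto hz)
  have hO' : (fun k => (q k : ℂ) * (Complex.log (1 + z k) - z k))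
      =O[atTop] fun k => (q k : ℂ) * z k * z k := by
    refine ((Asymptotics.isBigO_refl (fun k => (q k : ℂ)) atTop).mul hO).congr_right fun k => ?_
    simp only [Function.comp]
    ring
  have h0 : Tendsto (fun k => (q k : ℂ) * z k * z k) atTop (𝓝 0) := by simpa using h.mul hz
  have hlog : Tendsto (fun k => (q k : ℂ) * Complex.log (1 + z k)) atTop (𝓝 w) := by
    have := (hO'.trans_tendsto h0).add h
    rw [zero_add] at this
    exact this.congr fun k => by ring
  refine ((Complex.continuous_exp.tendsto w).comp hlog).congr' ?_
  have : ∀ᶠ k in atTop, 1 + z k ≠ 0 := by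
    have h1 : Tendsto (fun k => 1 + z k) atTop (𝓝 1) := by simpa using hz.const_add 1
    exact h1.eventually_ne one_ne_zero
  filter_upwards [this] with k hk
  rw [Function.comp_apply, Complex.exp_nat_mul, Complex.exp_log hk]

/-- A continuous function that is injective on a compact set has a continuous inverse there. -/
theorem IsCompact.tendsto_of_injOn {X Y α : Type*} [TopologicalSpace X] [TopologicalSpace Y]
    [T2Space Y] {K : Set X} (hK : IsCompact K) {φ : X → Y} (hc : ContinuousOn φ K)
    (hi : Set.InjOn φ K) {l : Filter α} {s : α → X} {y : X} (hs : ∀ᶠ i in l, s i ∈ K) (hy : y ∈ K)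
    (h : Tendsto (fun i => φ (s i)) l (𝓝 (φ y))) : Tendsto s l (𝓝 y) := by
  refine hK.tendsto_nhds_of_unique_mapClusterPt hs fun y' hy' hcl => ?_
  obtain ⟨U, hU, hUy⟩ := mapClusterPt_iff_ultrafilter.1 hcl
  have h1 : Tendsto s U (𝓝[K] y') := tendsto_nhdsWithin_iff.2 ⟨hUy, hU hs⟩
  exact hi hy' hy (tendsto_nhds_unique ((hc y' hy').tendsto.comp h1) (h.mono_left hU))

theorem exists_eventually_le_mul_of_liminf_pos {n : ℕ → ℕ} (hn : ∀ k, 0 < n k)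
    (h : 0 < liminf (fun k => (((n k : ℝ) / (n (k + 1) : ℝ) : ℝ) : EReal)) atTop) :
    ∃ C : ℝ, 0 < C ∧ ∀ᶠ k in atTop, (n (k + 1) : ℝ) ≤ C * n k := by
  obtain ⟨c, hc0, hc⟩ := EReal.lt_iff_exists_real_btwn.1 h
  have hc0' : 0 < c := by exact_mod_cast hc0
  refine ⟨c⁻¹, by positivity, (eventually_lt_of_lt_liminf hc).mono fun k hk => ?_⟩
  have hk' : c < (n k : ℝ) / n (k + 1) := by exact_mod_cast hk
  have : (0 : ℝ) < n (k + 1) := by exact_mod_cast hn (k + 1)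
  rw [lt_div_iff₀ this] at hk'
  rw [inv_mul_eq_div, le_div_iff₀ hc0']
  linarith

/-- In a sequence tending to infinity with bounded successive ratios, each late term is comparable
to a prescribed multiple of an earlier one. -/
theorem exists_tendsto_ratio_mem_Icc {n : ℕ → ℕ} (hpos : ∀ k, 0 < n k)
    (hn : Tendsto n atTop atTop) {C M : ℝ} (hM : 1 < M)
    (hC : ∀ᶠ k in atTop, (n (k + 1) : ℝ) ≤ C * n k) :
    ∃ u : ℕ → ℕ, Tendsto u atTop atTop ∧
      ∀ᶠ k in atTop, (n k : ℝ) / n (u k) ∈ Set.Icc M (M * C) := by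
  classical
  have hn' : Tendsto (fun k => (n k : ℝ)) atTop atTop := tendsto_natCast_atTop_atTop.comp hn
  -- The last index `j ≤ k` with `M n_j ≤ n_k`. The next index violates the inequality, so `n_k < M
  -- n_{u(k)+1} ≤ M C n_{u(k)}`.
  let u : ℕ → ℕ := fun k => Nat.findGreatest (fun j => M * n j ≤ n k) k
  have hlow : ∀ K, ∀ᶠ k in atTop, K ≤ u k ∧ M * n (u k) ≤ n k := by
    intro K
    filter_upwards [hn'.eventually_ge_atTop (M * n K), eventually_ge_atTop K] with k hk hKk
    exact ⟨Nat.le_findGreatest hKk hk, Nat.findGreatest_spec (P := fun j => M * n j ≤ n k) hKk hk⟩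
  refine ⟨u, tendsto_atTop.2 fun K => (hlow K).mono fun k hk => hk.1, ?_⟩
  obtain ⟨K, hK⟩ := eventually_atTop.1 hC
  filter_upwards [hlow K] with k hk
  have h0 : (0 : ℝ) < n (u k) := by exact_mod_cast hpos _
  have hk0 : (0 : ℝ) < n k := by exact_mod_cast hpos _
  rw [Set.mem_Icc, le_div_iff₀ h0, div_le_iff₀ h0]
  refine ⟨hk.2, ?_⟩
  -- Since `M > 1`, the index `k` itself does not qualify, so `u k + 1 ≤ k` lies in the range of the
  -- search.
  have hlt : u k < k := by
    refine lt_of_le_of_ne (Nat.findGreatest_le k) fun he => ?_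
    have := hk.2
    rw [he] at this
    nlinarith
  have h1 : ¬ M * n (u k + 1) ≤ n k :=
    Nat.findGreatest_is_greatest (P := fun j => M * n j ≤ n k) (Nat.lt_succ_self _) hlt
  have h2 := hK _ hk.1
  have : M * n (u k + 1) ≤ M * (C * n (u k)) := by gcongr
  linarith

/-! ### Local inversion of `φ` -/

/-- The functions `h k` vanish at `0` and converge continuously to `ψ` on `[-t₀, t₀]`. -/
structure LocalLimit (h : ℕ → ℝ → ℂ) (ψ : ℝ → ℂ) (t₀ : ℝ) : Prop where
  pos : 0 < t₀
  zero : ∀ k, h k 0 = 0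
  continuousOn : ContinuousOn ψ (Set.Icc (-t₀) t₀)
  tendsto : ∀ t ∈ Set.Icc (-t₀) t₀,
    Tendsto (fun p : ℕ × ℝ => h p.1 p.2) (atTop ×ˢ 𝓝[Set.Icc (-t₀) t₀] t) (𝓝 (ψ t))

/-- On a compact half-disc `K` the map `φ` is a homeomorphism onto its image, so convergence of
`φ(h_k)` passes to `h_k` once `h_k` is confined to `K`. Confinement holds near `t = 0` because `φ`
stays away from `1` on the bounding arc. -/
theorem exists_localLimit {φ : ℂ → ℂ} (hφ : IsLaplaceTransform φ) (hinv : IsInvertibleNearZero φ)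
    {f : ℝ → ℂ} (hf : IsCharFn f) {h : ℕ → ℝ → ℂ} (hcont : ∀ k, Continuous (h k))
    (h0 : ∀ k, h k 0 = 0) (hre : ∀ k t, 0 ≤ (h k t).re) (hcf : ∀ k, IsCharFn fun t => φ (h k t))
    (hlim : ∀ t, Tendsto (fun k => φ (h k t)) atTop (𝓝 (f t))) :
    ∃ (ψ : ℝ → ℂ) (t₀ r : ℝ), LocalLimit h ψ t₀ ∧
      (∀ t ∈ Set.Icc (-t₀) t₀, φ (ψ t) = f t) ∧
      ∀ᶠ k in atTop, ∀ t ∈ Set.Icc (-t₀) t₀, ‖h k t‖ ≤ r := by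
  obtain ⟨ε, hε, hinj⟩ := hinv
  set r := ε / 2
  have hr : 0 < r := by positivity
  have hrε : r < ε := half_lt_self hε
  let K : Set ℂ := {s | 0 ≤ s.re} ∩ Metric.closedBall 0 r
  have hre_closed : IsClosed {s : ℂ | 0 ≤ s.re} := isClosed_le continuous_const Complex.continuous_re
  have hK : IsCompact K := (isCompact_closedBall 0 r).inter_left hre_closed
  have hKc : ContinuousOn φ K := hφ.continuousOn.mono Set.inter_subset_left
  have hKi : Set.InjOn φ K := hinj.mono fun s hs =>
    show 0 ≤ s.re ∧ ‖s‖ < ε from ⟨hs.1, (mem_closedBall_zero_iff.1 hs.2).trans_lt hrε⟩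
  have h0K : (0 : ℂ) ∈ K := ⟨by simp, by simp [hr.le]⟩
  have hF := IsCharFn.tendsto_prod hcf hf hlim
  obtain ⟨δ, hδ, harc⟩ : ∃ δ > 0, ∀ s : ℂ, 0 ≤ s.re → ‖s‖ = r → δ ≤ ‖φ s - 1‖ := by
    have hA : IsCompact ({s : ℂ | 0 ≤ s.re} ∩ Metric.sphere 0 r) :=
      (isCompact_sphere 0 r).inter_left hre_closed
    have hsub : {s : ℂ | 0 ≤ s.re} ∩ Metric.sphere 0 r ⊆ K :=
      Set.inter_subset_inter_right _ Metric.sphere_subset_closedBall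
    obtain ⟨s₀, hs₀, hmin⟩ := hA.exists_isMinOn ⟨(r : ℂ), by simp [hr.le]⟩
      (((hKc.mono hsub).sub continuousOn_const).norm : ContinuousOn (fun s => ‖φ s - 1‖) _)
    refine ⟨‖φ s₀ - 1‖, norm_pos_iff.2 fun he => ?_, fun s hs hsr => hmin ⟨hs, by simpa using hsr⟩⟩
    have : s₀ = 0 := hKi (hsub hs₀) h0K (by rw [hφ.zero]; exact sub_eq_zero.1 he)
    have h2 := hs₀.2
    rw [this] at h2
    simp at h2
    exact hr.ne h2
  obtain ⟨t₀, ht₀, hsmall⟩ : ∃ t₀ > 0, ∀ᶠ k in atTop, ∀ t ∈ Set.Icc (-t₀) t₀,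
      ‖φ (h k t) - 1‖ < δ := by
    have := (hF 0).eventually (Metric.ball_mem_nhds _ hδ)
    obtain ⟨pa, hpa, pb, hpb, hab⟩ := eventually_prod_iff.1 this
    obtain ⟨η, hη, hball⟩ := Metric.eventually_nhds_iff.1 hpb
    refine ⟨η / 2, by positivity, hpa.mono fun k hk t ht => ?_⟩
    have := hab hk (hball (y := t) (by
      rw [Real.dist_eq, sub_zero]
      exact (abs_le.2 ht).trans_lt (half_lt_self hη)))
    rwa [hf.zero, dist_eq_norm] at this
  have hmem : ∀ᶠ k in atTop, ∀ t ∈ Set.Icc (-t₀) t₀, h k t ∈ K := by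
    filter_upwards [hsmall] with k hk t ht
    refine ⟨hre k t, ?_⟩
    rw [mem_closedBall_zero_iff]
    by_contra hcon
    -- A path from `h_k(0) = 0` to a point outside `K` would cross the arc `‖s‖ = r`, where `‖φ - 1‖
    -- ≥ δ`.
    obtain ⟨s, hs, hsr⟩ := intermediate_value_uIcc (a := 0) (b := t) (f := fun s => ‖h k s‖)
      (hcont k).norm.continuousOn (show r ∈ _ from by
        rw [h0, norm_zero]
        exact Set.mem_uIcc_of_le hr.le (not_le.1 hcon).le)
    have hsI : s ∈ Set.Icc (-t₀) t₀ :=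
      (Set.uIcc_subset_Icc (show (0 : ℝ) ∈ Set.Icc (-t₀) t₀ by constructor <;> linarith) ht) hs
    exact absurd (hk s hsI) (not_lt.2 (harc _ (hre k s) hsr))
  have hex : ∀ t ∈ Set.Icc (-t₀) t₀, ∃ y ∈ K, φ y = f t := fun t ht =>
    (hK.image_of_continuousOn hKc).isClosed.mem_of_tendsto (hlim t)
      (hmem.mono fun k hk => ⟨_, hk t ht, rfl⟩)
  choose! ψ hψK hψ using hex
  refine ⟨ψ, t₀, r, ⟨ht₀, h0, fun t ht => ?_, fun t ht => ?_⟩, hψ, ?_⟩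
  · refine hK.tendsto_of_injOn hKc hKi (eventually_mem_nhdsWithin.mono hψK) (hψK t ht) ?_
    rw [hψ t ht]
    refine (hf.continuous.continuousWithinAt (s := Set.Icc (-t₀) t₀)).tendsto.congr' ?_
    exact eventually_mem_nhdsWithin.mono fun s hs => (hψ s hs).symm
  · refine hK.tendsto_of_injOn hKc hKi ?_ (hψK t ht) ?_
    · exact (hmem.prod_mk (eventually_mem_nhdsWithin (a := t))).mono fun p hp => hp.1 _ hp.2
    · rw [hψ t ht]
      exact (hF t).mono_left (prod_mono_right _ nhdsWithin_le_nhds)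
  · exact hmem.mono fun k hk t ht => mem_closedBall_zero_iff.1 (hk t ht).2

/-! ### Contractions and extension of the local limit to the line -/

/-- Each late `h k` is a multiple, by a bounded factor `> 1`, of an earlier member of the family
evaluated on an arbitrarily strongly contracted argument. -/
def HasContractions (h : ℕ → ℝ → ℂ) : Prop :=
  ∀ δ : ℝ, 0 < δ → ∃ (M C : ℝ) (u : ℕ → ℕ) (R β : ℕ → ℝ), 1 < M ∧ Tendsto u atTop atTop ∧
    (∀ᶠ k in atTop, R k ∈ Set.Icc M C) ∧ (∀ᶠ k in atTop, β k ∈ Set.Icc 0 δ) ∧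
    ∀ k t, h k t = R k * h (u k) (β k * t)

theorem mem_Icc_of_abs_le {x t : ℝ} (h : |x| ≤ t) : x ∈ Set.Icc (-t) t := abs_le.1 h

theorem exists_pow_mul_abs_le {b t₀ : ℝ} (hb0 : 0 < b) (hb1 : b < 1) (ht₀ : 0 < t₀) (t : ℝ) :
    ∃ m : ℕ, |b ^ m * t| ≤ t₀ := by
  have hlim : Tendsto (fun m : ℕ => |b ^ m * t|) atTop (𝓝 0) := by
    simpa using ((tendsto_pow_atTop_nhds_zero_of_lt_one hb0.le hb1).mul_const t).abs
  exact ((hlim.eventually (gt_mem_nhds ht₀)).exists).imp fun m hm => hm.le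

namespace LocalLimit

variable {h : ℕ → ℝ → ℂ} {ψ : ℝ → ℂ} {t₀ : ℝ}

theorem tendsto_comp (L : LocalLimit h ψ t₀) {v : ℕ → ℕ} {x : ℕ → ℝ} {t : ℝ}
    (hv : Tendsto v atTop atTop) (hx : Tendsto x atTop (𝓝 t))
    (hm : ∀ᶠ j in atTop, |x j| ≤ t₀) :
    Tendsto (fun j => h (v j) (x j)) atTop (𝓝 (ψ t)) := by
  have hx' : Tendsto x atTop (𝓝[Set.Icc (-t₀) t₀] t) :=
    tendsto_nhdsWithin_iff.2 ⟨hx, hm.mono fun j hj => mem_Icc_of_abs_le hj⟩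
  have ht : t ∈ Set.Icc (-t₀) t₀ :=
    isClosed_Icc.mem_of_tendsto hx (hm.mono fun j hj => mem_Icc_of_abs_le hj)
  exact (L.tendsto t ht).comp (hv.prodMk hx')

theorem tendsto_apply (L : LocalLimit h ψ t₀) {t : ℝ} (ht : |t| ≤ t₀) :
    Tendsto (fun k => h k t) atTop (𝓝 (ψ t)) :=
  L.tendsto_comp tendsto_id tendsto_const_nhds (Eventually.of_forall fun _ => ht)

theorem map_zero (L : LocalLimit h ψ t₀) : ψ 0 = 0 := by
  have := L.tendsto_apply (t := 0) (by simpa using L.pos.le)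
  simp only [L.zero] at this
  exact tendsto_nhds_unique this tendsto_const_nhds

/-- The scale ratio is `β_k = a_{u(k)}/a_k`. If `β_k > δ`, a point `s` with `ψ(s) ≠ 0` and `|s| < δ
t₀` gives `s/β_k` in `[-t₀, t₀]`, where `h_k` equals `R_k h_{u(k)}(s)`. For `M` large this exceeds
the bound `r`. -/
theorem hasContractions {g : ℝ → ℂ} {n : ℕ → ℕ} {a : ℕ → ℝ} {C r : ℝ}
    (L : LocalLimit (fun k t => (n k : ℂ) * (1 - g (t / a k))) ψ t₀) (hpos : ∀ k, 0 < n k)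
    (hn : Tendsto n atTop atTop) (ha : ∀ k, 0 < a k)
    (hC : ∀ᶠ k in atTop, (n (k + 1) : ℝ) ≤ C * n k)
    (hr : ∀ᶠ k in atTop, ∀ t ∈ Set.Icc (-t₀) t₀, ‖(n k : ℂ) * (1 - g (t / a k))‖ ≤ r)
    (hψ : ∃ᶠ s in 𝓝 0, ψ s ≠ 0) :
    HasContractions fun k t => (n k : ℂ) * (1 - g (t / a k)) := by
  intro δ hδ
  have ht₀ := L.pos
  obtain ⟨s, hs0, hs⟩ : ∃ s, ψ s ≠ 0 ∧ |s| < min (δ * t₀) t₀ := by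
    have : ∀ᶠ s : ℝ in 𝓝 0, |s| < min (δ * t₀) t₀ := by
      have := (continuous_abs (G := ℝ)).tendsto 0
      rw [abs_zero] at this
      exact this.eventually (gt_mem_nhds (by positivity))
    exact (hψ.and_eventually this).exists
  have hsδ : |s| < δ * t₀ := hs.trans_le (min_le_left _ _)
  have hst : |s| < t₀ := hs.trans_le (min_le_right _ _)
  have hr0 : 0 ≤ r := by
    obtain ⟨k, hk⟩ := hr.exists
    exact (norm_nonneg _).trans (hk 0 (mem_Icc_of_abs_le (by simpa using ht₀.le)))
  have hψs : 0 < ‖ψ s‖ := norm_pos_iff.2 hs0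
  -- Large enough that `M ‖ψ s‖ > r`; the summand `2` also secures `M > 1`.
  set M := r / ‖ψ s‖ + 2
  have hM : 1 < M := by
    have : 0 ≤ r / ‖ψ s‖ := by positivity
    linarith
  have hMr : r / M < ‖ψ s‖ := by
    rw [div_lt_iff₀ (by linarith)]
    have : ‖ψ s‖ * M = r + ‖ψ s‖ * 2 := by simp only [M]; field_simp
    linarith
  obtain ⟨u, hu, hR⟩ := exists_tendsto_ratio_mem_Icc hpos hn hM hC
  have hsc : ∀ k t, (n k : ℂ) * (1 - g (t / a k)) = ((n k : ℝ) / n (u k) : ℝ)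
      * ((n (u k) : ℂ) * (1 - g (a (u k) / a k * t / a (u k)))) := by
    intro k t
    have h1 : (n (u k) : ℂ) ≠ 0 := by exact_mod_cast (hpos _).ne'
    have h2 := (ha (u k)).ne'
    have h3 : a (u k) / a k * t / a (u k) = t / a k := by field_simp
    rw [h3]
    push_cast
    field_simp
  refine ⟨M, M * C, u, fun k => n k / n (u k), fun k => a (u k) / a k, hM, hu, hR, ?_, hsc⟩
  have hlarge := (L.tendsto_comp hu (tendsto_const_nhds (x := s))
    (Eventually.of_forall fun _ => hst.le)).norm.eventually (lt_mem_nhds hMr)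
  filter_upwards [hlarge, hr, hR] with k h1 h2 h3
  have hβ : 0 < a (u k) / a k := div_pos (ha _) (ha _)
  refine ⟨hβ.le, not_lt.1 fun hlt => h1.not_ge ?_⟩
  have h4 := h2 (s / (a (u k) / a k)) (mem_Icc_of_abs_le (by
    rw [abs_div, abs_of_pos hβ, div_le_iff₀ hβ]
    nlinarith))
  have hn0 : (0 : ℝ) < (n k : ℝ) / n (u k) := by linarith [h3.1]
  rw [hsc, norm_mul, Complex.norm_real, Real.norm_of_nonneg hn0.le,
    mul_div_cancel₀ s hβ.ne'] at h4
  rw [le_div_iff₀ (by linarith), mul_comm]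
  exact (mul_le_mul_of_nonneg_right h3.1 (norm_nonneg _)).trans h4

/-- Along a subsequence of any sequence of indices, the limit is obtained from `ψ` by scaling. -/
theorem exists_subseq (L : LocalLimit h ψ t₀) (hc : HasContractions h) {δ : ℝ} (hδ : 0 < δ)
    (hδ1 : δ ≤ 1) {v : ℕ → ℕ} (hv : Tendsto v atTop atTop) :
    ∃ (w : ℕ → ℕ) (a b : ℝ), Tendsto w atTop atTop ∧ 1 < a ∧ b ∈ Set.Icc 0 δ ∧
      (∀ t, δ * |t| ≤ t₀ → Tendsto (fun j => h (v (w j)) t) atTop (𝓝 (a * ψ (b * t)))) ∧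
      ∀ t, |t| ≤ t₀ → ψ t = a * ψ (b * t) := by
  obtain ⟨M, C, u, R, β, hM, hu, hR, hβ, hsc⟩ := hc δ hδ
  have hmem := hv.eventually (hR.and hβ)
  obtain ⟨⟨a, b⟩, hab, w, hw, hlim⟩ := (isCompact_Icc.prod isCompact_Icc).tendsto_subseq'
    (x := fun j => (R (v j), β (v j))) (s := Set.Icc M C ×ˢ Set.Icc 0 δ)
    (hmem.mono fun j hj => ⟨hj.1, hj.2⟩).frequently
  have hvw := hv.comp hw.tendsto_atTop
  have h1 : ∀ t, δ * |t| ≤ t₀ →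
      Tendsto (fun j => h (v (w j)) t) atTop (𝓝 (a * ψ (b * t))) := by
    intro t ht
    have ha : Tendsto (fun j => R (v (w j))) atTop (𝓝 a) := (continuous_fst.tendsto _).comp hlim
    have hb : Tendsto (fun j => β (v (w j))) atTop (𝓝 b) := (continuous_snd.tendsto _).comp hlim
    have := ((Complex.continuous_ofReal.tendsto a).comp ha).mul
      (L.tendsto_comp (hu.comp hvw) (hb.mul_const t) ((hvw.eventually hβ).mono fun j hj => by
        rw [abs_mul, abs_of_nonneg (show 0 ≤ β (v (w j)) from hj.1)]
        exact (mul_le_mul_of_nonneg_right hj.2 (abs_nonneg t)).trans ht))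
    exact this.congr fun j => (hsc _ _).symm
  refine ⟨w, a, b, hw.tendsto_atTop, hM.trans_le hab.1.1, hab.2, h1, fun t ht => ?_⟩
  refine tendsto_nhds_unique ((L.tendsto_apply ht).comp hvw) (h1 t ?_)
  exact (mul_le_of_le_one_left (abs_nonneg t) hδ1).trans ht

theorem eq_pow_mul_of_eq_mul {a b : ℝ} (hb0 : 0 ≤ b) (hb1 : b ≤ 1)
    (hab : ∀ t, |t| ≤ t₀ → ψ t = a * ψ (b * t)) (m : ℕ) {t : ℝ} (ht : |t| ≤ t₀) :
    ψ t = (a : ℂ) ^ m * ψ (b ^ m * t) := by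
  induction m with
  | zero => simp
  | succ m ih =>
    rw [ih, hab (b ^ m * t), pow_succ, pow_succ', mul_assoc, mul_assoc]
    rw [abs_mul, abs_of_nonneg (pow_nonneg hb0 m)]
    exact (mul_le_of_le_one_left (abs_nonneg t) (pow_le_one₀ hb0 hb1)).trans ht

/-- The relation `ψ(t) = a ψ(bt)` lets `Ψ(t) = a^m ψ(b^m t)` be defined for any `m` with `|b^m t| ≤
t₀`, independently of `m`. Subsequential limits of `h_k` have the form `a' ψ(b't)` with another such
pair `(a', b')`; the two scalings commute, so all these limits equal `Ψ`. -/
theorem extend (L : LocalLimit h ψ t₀) (hc : HasContractions h)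
    (hψ : ∃ t, |t| ≤ t₀ ∧ ψ t ≠ 0) :
    ∃ (Ψ : ℝ → ℂ) (a b : ℝ), Continuous Ψ ∧ 1 < a ∧ 0 < b ∧ b < 1 ∧
      (∀ t, Ψ t = a * Ψ (b * t)) ∧ ∀ t, Tendsto (fun k => h k t) atTop (𝓝 (Ψ t)) := by
  have ht₀ := L.pos
  obtain ⟨-, a, b, -, ha, hb, -, hab⟩ :=
    L.exists_subseq hc (δ := 2⁻¹) (by norm_num) (by norm_num) tendsto_id
  have hb1 : b < 1 := hb.2.trans_lt (by norm_num)
  -- With `b = 0` the relation would force `ψ = a ψ(0) = 0` on the whole interval.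
  have hb0 : 0 < b := by
    refine lt_of_le_of_ne hb.1 fun he => ?_
    obtain ⟨t, ht, hne⟩ := hψ
    exact hne (by rw [hab t ht, ← he, zero_mul, L.map_zero, mul_zero])
  have hex := exists_pow_mul_abs_le hb0 hb1 ht₀
  choose m hm using hex
  let Ψ : ℝ → ℂ := fun t => (a : ℂ) ^ m t * ψ (b ^ m t * t)
  have hshift : ∀ (t : ℝ) (i j : ℕ), |b ^ i * t| ≤ t₀ →
      (a : ℂ) ^ i * ψ (b ^ i * t) = (a : ℂ) ^ (i + j) * ψ (b ^ (i + j) * t) := by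
    intro t i j hi
    rw [eq_pow_mul_of_eq_mul hb0.le hb1.le hab j hi, pow_add, pow_add, mul_assoc, ← mul_assoc (b ^ j),
      mul_comm (b ^ j)]
  have hΨ : ∀ (t : ℝ) (i : ℕ), |b ^ i * t| ≤ t₀ → Ψ t = (a : ℂ) ^ i * ψ (b ^ i * t) := by
    intro t i hi
    rw [hshift t i (m t) hi, add_comm]
    exact hshift t (m t) i (hm t)
  refine ⟨Ψ, a, b, ?_, ha, hb0, hb1, fun t => ?_, fun t => ?_⟩
  · refine continuous_iff_continuousAt.2 fun t => ?_
    obtain ⟨i, hi⟩ := exists_pow_mul_abs_le hb0 hb1 ht₀ (|t| + 1)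
    have hin : ∀ x ∈ Metric.ball t 1, |b ^ i * x| ≤ t₀ := fun x hx => by
      refine le_trans ?_ hi
      rw [abs_mul, abs_mul, abs_of_nonneg (show 0 ≤ |t| + 1 by positivity)]
      gcongr
      rw [Metric.mem_ball, Real.dist_eq] at hx
      have := abs_sub_abs_le_abs_sub x t
      linarith
    have hcont : ContinuousOn (fun x => (a : ℂ) ^ i * ψ (b ^ i * x)) (Metric.ball t 1) :=
      continuousOn_const.mul (L.continuousOn.comp (by fun_prop)
        fun x hx => mem_Icc_of_abs_le (hin x hx))
    exact (hcont.congr fun x hx => hΨ x i (hin x hx)).continuousAt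
      (Metric.ball_mem_nhds t one_pos)
  · have h1 : |b ^ m t * (b * t)| ≤ t₀ := by
      rw [mul_left_comm, abs_mul, abs_of_pos hb0]
      exact (mul_le_of_le_one_left (abs_nonneg _) hb1.le).trans (hm t)
    rw [hΨ _ _ h1, ← mul_assoc, ← mul_assoc, ← pow_succ', ← pow_succ]
    exact hshift t (m t) 1 (hm t)
  · refine tendsto_of_subseq_tendsto fun v hv => ?_
    -- A contraction by this factor brings the given `t` into `[-t₀, t₀]`.
    have hδ : 0 < min 1 (t₀ / (|t| + 1)) := by positivity
    obtain ⟨w, a', b', -, -, hb', hlim, hab'⟩ := L.exists_subseq hc hδ (min_le_left _ _) hv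
    have hδt : min 1 (t₀ / (|t| + 1)) * |t| ≤ t₀ := by
      refine (mul_le_mul_of_nonneg_right (min_le_right _ _) (abs_nonneg t)).trans ?_
      rw [div_mul_eq_mul_div, div_le_iff₀ (by positivity)]
      nlinarith [abs_nonneg t]
    refine ⟨w, ?_⟩
    convert! hlim t hδt using 2
    have h1 : |b' * t| ≤ t₀ := by
      rw [abs_mul, abs_of_nonneg hb'.1]
      exact (mul_le_mul_of_nonneg_right hb'.2 (abs_nonneg t)).trans hδt
    -- Both sides become `a^m a' ψ(b^m b' t)`.
    rw [hΨ t _ (hm t), hab' _ (hm t), eq_pow_mul_of_eq_mul hb0.le hb1.le hab (m t) h1,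
      mul_left_comm, mul_left_comm b']

end LocalLimit

/-! ### Distinguished logarithms and the two implications -/

theorem Complex.eq_zero_of_exp_eq_one {z : ℂ} (h : Complex.exp z = 1) (hz : ‖z‖ < 1) : z = 0 := by
  obtain ⟨m, rfl⟩ := Complex.exp_eq_one_iff.1 h
  rcases eq_or_ne m 0 with rfl | hm
  · simp
  · have h1 : (1 : ℝ) ≤ |(m : ℝ)| := by exact_mod_cast Int.one_le_abs hm
    have h2 := Real.pi_gt_three
    rw [norm_mul, norm_mul, norm_mul, Complex.norm_intCast, Complex.norm_real, Complex.norm_I,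
      Complex.norm_two, mul_one, Real.norm_of_nonneg Real.pi_pos.le] at hz
    nlinarith

/-- The difference is continuous with values in the discrete group `2πiℤ`, hence constant. -/
theorem IsNegLog.unique {ψ ψ' ω : ℝ → ℂ} (h : IsNegLog ψ ω) (h' : IsNegLog ψ' ω) : ψ = ψ' := by
  have hd : Continuous fun t => ψ t - ψ' t := h.continuous.sub h'.continuous
  have he : ∀ t, Complex.exp (ψ t - ψ' t) = 1 := fun t => by
    have := (h.exp_neg t).symm.trans (h'.exp_neg t)
    rw [← neg_sub_neg, Complex.exp_sub, ← this, div_self (Complex.exp_ne_zero _)]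
  have hloc : IsLocallyConstant fun t => ψ t - ψ' t := by
    refine (IsLocallyConstant.iff_eventually_eq _).2 fun t => ?_
    filter_upwards [hd.continuousAt.eventually (Metric.ball_mem_nhds _ one_pos)] with s hs
    rw [dist_eq_norm] at hs
    refine sub_eq_zero.1 (Complex.eq_zero_of_exp_eq_one ?_ hs)
    rw [Complex.exp_sub, he, he, div_one]
  ext t
  have := hloc.apply_eq_of_preconnectedSpace t 0
  simp only [h.zero, h'.zero, sub_self] at this
  exact sub_eq_zero.1 this

theorem isPhiSemiStable_of_eq_one {φ : ℂ → ℂ} (hφ : IsLaplaceTransform φ) {f : ℝ → ℂ}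
    (hf : ∀ t, f t = 1) : IsPhiSemiStable φ f := by
  have hlog : IsNegLog (fun _ => 0) (fun _ => 1) := ⟨continuous_const, rfl, fun t => by simp⟩
  refine ⟨fun _ => 1, fun _ => 0, ⟨⟨IsCharFn.one, fun n _ => ⟨fun _ => 1, IsCharFn.one, by simp⟩⟩,
    _, hlog, 2, 2⁻¹, ?_⟩, hlog, fun t => by rw [hf, hφ.zero]⟩
  norm_num

theorem tendsto_nat_floor_pow_div {a : ℝ} (ha : 1 < a) :
    Tendsto (fun k : ℕ => (⌊a ^ k⌋₊ : ℝ) / a ^ k) atTop (𝓝 1) :=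
  tendsto_nat_floor_div_atTop.comp (tendsto_pow_atTop_atTop_of_one_lt ha)

/-- A semi-stable characteristic function is partially attracted to its own `φ`-version. -/
theorem IsPhiSemiStable.nonempty_strictPartialDomain {φ : ℂ → ℂ} (hφ : IsLaplaceTransform φ)
    {f : ℝ → ℂ} (h : IsPhiSemiStable φ f) : (strictPartialDomain φ f).Nonempty := by
  obtain ⟨ω, ψ, ⟨⟨hω, -⟩, ψ', hψ', a, b, ha, hb0, -, hab⟩, hψ, hf⟩ := h
  obtain rfl := hψ.unique hψ'
  have ha0 : 0 < a := one_pos.trans ha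
  have hpow : ∀ (k : ℕ) t, ψ t = (a : ℂ) ^ k * ψ (b ^ k * t) := by
    intro k
    induction k with
    | zero => simp
    | succ k ih =>
      intro t
      rw [ih, hab, pow_succ, pow_succ', mul_assoc, mul_assoc]
  have hfl := tendsto_nat_floor_pow_div ha
  have hpos : ∀ k : ℕ, 0 < ⌊a ^ k⌋₊ := fun k => Nat.floor_pos.2 (one_le_pow₀ ha.le)
  -- Iterating the relation gives `ψ(b^k t) = a^{-k} ψ(t)`, which dictates `a_k = b^{-k}` and `n_k ~
  -- a^k`; successive ratios `n_k/n_{k+1}` tend to `1/a`.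
  refine ⟨ω, hω, fun k => ⌊a ^ k⌋₊, fun k => (b ^ k)⁻¹, ⟨hpos, ?_, fun k => by positivity, ?_⟩, ?_⟩
  · exact tendsto_nat_floor_atTop.comp (tendsto_pow_atTop_atTop_of_one_lt ha)
  · intro t
    simp only [Complex.ofReal_zero, mul_zero, neg_zero, Complex.exp_zero, mul_one, hf]
    have hre : 0 ≤ (ψ t).re := by
      have := hω.norm_le t
      rw [hψ.exp_neg, Complex.norm_exp, Real.exp_le_one_iff, Complex.neg_re] at this
      linarith
    -- The limit of `a^k(1 - exp(-a^{-k} ψ(t)))` is this derivative, read along `y = a^{-k}`.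
    have hderiv : HasDerivAt (fun y : ℝ => 1 - Complex.exp (-(y * ψ t))) (ψ t) 0 := by
      have h1 := (((Complex.ofRealCLM.hasDerivAt (x := (0 : ℝ))).mul_const (ψ t)).neg.cexp).const_sub 1
      simpa using h1
    have hinv : Tendsto (fun k : ℕ => (a ^ k)⁻¹) atTop (𝓝[≠] 0) :=
      tendsto_nhdsWithin_iff.2 ⟨tendsto_inv_atTop_zero.comp (tendsto_pow_atTop_atTop_of_one_lt ha),
        Eventually.of_forall fun k => by simp [ha0.ne']⟩
    have hlim := ((Complex.continuous_ofReal.tendsto 1).comp hfl).mul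
      (hderiv.tendsto_slope_zero.comp hinv)
    have hlim' : Tendsto (fun k : ℕ => (⌊a ^ k⌋₊ : ℂ) * (1 - ω (t / (b ^ k)⁻¹))) atTop (𝓝 (ψ t)) := by
      rw [Complex.ofReal_one, one_mul] at hlim
      refine hlim.congr fun k => ?_
      have hk : (a : ℂ) ^ k ≠ 0 := pow_ne_zero _ (by exact_mod_cast ha0.ne')
      have hψk : ψ (b ^ k * t) = ((a : ℂ) ^ k)⁻¹ * ψ t := by rw [hpow k t]; field_simp
      rw [div_inv_eq_mul, mul_comm t, hψ.exp_neg, hψk]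
      simp only [Function.comp_apply, zero_add, Complex.ofReal_zero, zero_mul, neg_zero,
        Complex.exp_zero, sub_self, sub_zero, inv_inv, Complex.real_smul]
      push_cast
      field_simp
    refine (hφ.continuousOn (ψ t) hre).tendsto.comp
      (tendsto_nhdsWithin_iff.2 ⟨hlim', Eventually.of_forall fun k => ?_⟩)
    have := hω.one_sub_re_nonneg (t / (b ^ k)⁻¹)
    change 0 ≤ (_ : ℂ).re
    rw [← Complex.ofReal_natCast, Complex.re_ofReal_mul]
    positivity
  · have h1 : Tendsto (fun k : ℕ => (⌊a ^ k⌋₊ : ℝ) / (⌊a ^ (k + 1)⌋₊ : ℝ)) atTop (𝓝 a⁻¹) := by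
      have := (hfl.div (hfl.comp (tendsto_add_atTop_nat 1)) one_ne_zero).mul_const a⁻¹
      rw [div_one, one_mul] at this
      refine this.congr fun k => ?_
      have h2 : (⌊a ^ (k + 1)⌋₊ : ℝ) ≠ 0 := by exact_mod_cast (hpos (k + 1)).ne'
      simp only [Pi.div_apply, Function.comp_apply]
      field_simp
      ring
    have h2 := ((continuous_coe_real_ereal.tendsto _).comp h1).liminf_eq
    refine lt_of_lt_of_eq ?_ h2.symm
    exact_mod_cast inv_pos.2 ha0

/-- A characteristic function partially attracted along a sequence of bounded successive ratios is
`φ`-semi-stable. -/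
theorem isPhiSemiStable_of_tendsto {φ : ℂ → ℂ} (hφ : IsLaplaceTransform φ)
    (hinv : IsInvertibleNearZero φ) {f g : ℝ → ℂ} (hf : IsCharFn f) (hg : IsCharFn g)
    {n : ℕ → ℕ} {a : ℕ → ℝ} {C : ℝ} (hpos : ∀ k, 0 < n k) (hn : Tendsto n atTop atTop)
    (ha : ∀ k, 0 < a k) (hC : ∀ᶠ k in atTop, (n (k + 1) : ℝ) ≤ C * n k)
    (hlim : ∀ t, Tendsto (fun k => φ ((n k : ℂ) * (1 - g (t / a k)))) atTop (𝓝 (f t))) :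
    IsPhiSemiStable φ f := by
  have hre : ∀ k t, 0 ≤ ((n k : ℂ) * (1 - g (t / a k))).re := fun k t => by
    have := hg.one_sub_re_nonneg (t / a k)
    rw [← Complex.ofReal_natCast, Complex.re_ofReal_mul]
    positivity
  obtain ⟨ψ, t₀, r, L, hψf, hr⟩ := exists_localLimit hφ hinv hf
    (h := fun k t => (n k : ℂ) * (1 - g (t / a k)))
    (fun k => by have := hg.continuous; fun_prop) (fun k => by simp [hg.zero]) hre
    (fun k => by simpa using hφ.isCharFn_comp (hg.comp_div (a k)) (n k).cast_nonneg) hlim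
  have hnhds : ∀ᶠ s in 𝓝 (0 : ℝ), s ∈ Set.Icc (-t₀) t₀ :=
    Icc_mem_nhds (neg_lt_zero.2 L.pos) L.pos
  -- The contraction argument needs nonzero values of `ψ` arbitrarily close to `0`; otherwise `f` is
  -- `1` near `0`, hence everywhere.
  by_cases hψ : ∃ᶠ s in 𝓝 0, ψ s ≠ 0
  swap
  · refine isPhiSemiStable_of_eq_one hφ (hf.eq_one_of_eventually ?_)
    filter_upwards [not_frequently.1 hψ, hnhds] with s hs hsI
    rw [← hψf s hsI, not_not.1 hs, hφ.zero]
  obtain ⟨Ψ, c, b, hΨc, hc, hb0, hb1, hself, hΨ⟩ := L.extend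
    (L.hasContractions hpos hn ha hC hr hψ)
    ((hψ.and_eventually hnhds).exists.imp fun s hs => ⟨abs_le.2 hs.2, hs.1⟩)
  -- The `m`-th root of `exp(-Ψ)` is the limit of the characteristic functions `g(t/a_k)^⌊n_k/m⌋`,
  -- as `⌊n_k/m⌋/n_k → 1/m`.
  have hroot : ∀ m : ℕ, 0 < m → IsCharFn fun t => Complex.exp (-(Ψ t / m)) := by
    intro m hm
    have hq : Tendsto (fun k => n k / m) atTop atTop :=
      (Nat.tendsto_div_const_atTop hm.ne').comp hn
    refine IsCharFn.of_tendsto (F := fun k t => g (t / a k) ^ (n k / m))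
      (fun k => (hg.comp_div (a k)).pow _) (by fun_prop) fun t => ?_
    have hratio : Tendsto (fun k => ((n k / m : ℕ) : ℝ) / n k) atTop (𝓝 (m : ℝ)⁻¹) := by
      have h1 := (tendsto_nat_floor_mul_div_atTop (R := ℝ) (a := (m : ℝ)⁻¹) (by positivity)).comp
        ((tendsto_natCast_atTop_atTop (R := ℝ)).comp hn)
      refine h1.congr fun k => ?_
      simp only [Function.comp_apply]
      rw [inv_mul_eq_div, Nat.floor_div_natCast, Nat.floor_natCast]
    have h2 := (((Complex.continuous_ofReal.tendsto _).comp hratio).mul (hΨ t)).neg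
    have h3 : Tendsto (fun k => ((n k / m : ℕ) : ℂ) * (g (t / a k) - 1)) atTop
        (𝓝 (-(Ψ t / m))) := by
      convert! h2 using 2 with k
      · have : (n k : ℂ) ≠ 0 := by exact_mod_cast (hpos k).ne'
        simp only [Function.comp_apply, Complex.ofReal_div, Complex.ofReal_natCast]
        field_simp
        ring
      · push_cast
        ring
    simpa using tendsto_one_add_pow_exp hq h3
  have hΨ0 : Ψ 0 = 0 := by
    have := hΨ 0
    simp only [zero_div, hg.zero, sub_self, mul_zero] at this
    exact tendsto_nhds_unique this tendsto_const_nhds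
  have hlog : IsNegLog Ψ fun t => Complex.exp (-Ψ t) := ⟨hΨc, hΨ0, fun _ => rfl⟩
  refine ⟨fun t => Complex.exp (-Ψ t), Ψ, ⟨⟨by simpa using hroot 1 one_pos, fun m hm =>
    ⟨_, hroot m hm, fun t => ?_⟩⟩, Ψ, hlog, c, b, hc, hb0, hb1, hself⟩, hlog, fun t => ?_⟩
  · have : (m : ℂ) ≠ 0 := by exact_mod_cast (Nat.pos_of_ne_zero (by omega)).ne'
    rw [← Complex.exp_nat_mul]
    field_simp
  -- Continuity of `φ` is available only within the closed half-plane, so the limit point must be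
  -- shown to lie there.
  · have hΨre : 0 ≤ (Ψ t).re :=
      ge_of_tendsto' ((Complex.continuous_re.tendsto _).comp (hΨ t)) fun k => hre k t
    exact tendsto_nhds_unique (hlim t) ((hφ.continuousOn (Ψ t) hΨre).tendsto.comp
      (tendsto_nhdsWithin_iff.2 ⟨hΨ t, Eventually.of_forall fun k => hre k t⟩))

theorem theorem4p3 (φ : ℂ → ℂ) (hφ : IsLaplaceTransform φ) (hinv : IsInvertibleNearZero φ)
    (f : ℝ → ℂ) (hf : IsCharFn f) :
    (strictPartialDomain φ f).Nonempty ↔ IsPhiSemiStable φ f := by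
  refine ⟨?_, fun h => h.nonempty_strictPartialDomain hφ⟩
  rintro ⟨g, hg, n, a, ⟨hpos, hn, ha, hlim⟩, hliminf⟩
  obtain ⟨C, -, hC⟩ := exists_eventually_le_mul_of_liminf_pos hpos hliminf
  exact isPhiSemiStable_of_tendsto hφ hinv hf hg hpos hn ha hC (by simpa using hlim)
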